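/- Let $F$ be a finite field with $q=|F|$ elements, let $q\not\equiv 3\pmod 4$, and let $\lambda\in F^\times$. For $n\ge 1$, a linear subspace $C\subseteq F^n\times F^n$ (a linear code of length $2n$) is called a $2$-quasi $\lambda$-constacyclic code if $(c_0,c_1,\dots,c_{n-1},\,c'_0,c'_1,\dots,c'_{n-1})\in C$ implies $(\lambda c_{n-1},c_0,\dots,c_{n-2},\,\lambda c'_{n-1},c'_0,\dots,c'_{n-2})\in C$. It is called self-dual if $C=C^{\perp}$, where $C^\perp$ is the dual of $C$ with respect to the Euclidean inner product $\langle \mathbf a,\mathbf b\rangle=\sum_i a_ib_i$ on $F^{2n}$. A class of linear codes over $F$ is called asymptotically good if it contains a sequence of codes $C_1,C_2,\dots$, with $C_i$ of length $N_i$, such that $N_i\to\infty$ and, for some real number $\delta>0$, both $\dim_F(C_i)/N_i>\delta$ and $d(C_i)/N_i>\delta$ hold for all $i\ge 1$, where $d(C_i)$ is the minimum Hamming distance between distinct codewords of $C_i$; otherwise the class is called asymptotically bad. Then the class of self-dual $2$-quasi $\lambda$-constacyclic codes over $F$ (of all lengths $2n$, $n\ge1$) is asymptotically good if and only if $\lambda^2=1$.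 -/

import Mathlib

open Filter

namespace TwoQuasi

/-- The minimum distance `d(C)` of a code `C ⊆ F ^ N`: the least Hamming distance between two
distinct codewords (with the value `0` if there are no two distinct codewords). -/
noncomputable def minDist {F : Type*} [Field F] [DecidableEq F] {N : ℕ}
    (C : Submodule F (Fin N → F)) : ℕ :=
  sInf {d : ℕ | ∃ c ∈ C, ∃ c' ∈ C, c ≠ c' ∧ d = hammingDist c c'}

/-- The relative minimum distance `Δ(C) = d(C) / N` of a linear code of length `N`. -/
noncomputable def relMinDist {F : Type*} [Field F] [DecidableEq F] {N : ℕ}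
    (C : Submodule F (Fin N → F)) : ℝ :=
  (minDist C : ℝ) / (N : ℝ)

/-- The rate `R(C) = dim C / N` of a linear code of length `N`. -/
noncomputable def rate {F : Type*} [Field F] {N : ℕ} (C : Submodule F (Fin N → F)) : ℝ :=
  (Module.finrank F C : ℝ) / (N : ℝ)

/-- The Euclidean dual code `{a | ∀ c ∈ C, ∑ i, c i * a i = 0}`. -/
def dualCode {F : Type*} [Field F] {N : ℕ} (C : Submodule F (Fin N → F)) :
    Submodule F (Fin N → F) where
  carrier := {a | ∀ c ∈ C, ∑ i, c i * a i = 0}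
  zero_mem' := by
    intro c _
    simp
  add_mem' := by
    intro a b ha hb c hc
    have h1 := ha c hc
    have h2 := hb c hc
    simp only [Pi.add_apply, mul_add, Finset.sum_add_distrib, h1, h2, add_zero]
  smul_mem' := by
    intro r a ha c hc
    have h1 := ha c hc
    simp only [Pi.smul_apply, smul_eq_mul, mul_left_comm _ r, ← Finset.mul_sum, h1, mul_zero]

/-- A linear code is (Euclidean) self-dual if it is equal to its dual code. -/
def IsSelfDual {F : Type*} [Field F] {N : ℕ} (C : Submodule F (Fin N → F)) : Prop :=
  C = dualCode C

/-- The `lam`-constacyclic permutation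
`(c_0, c_1, …, c_{n-1}) ↦ (lam * c_{n-1}, c_0, …, c_{n-2})`. -/
def constaShift {F : Type*} [Field F] (lam : F) {n : ℕ} (c : Fin n → F) : Fin n → F :=
  fun i => if (i : ℕ) = 0 then lam * c ⟨n - 1, Nat.sub_lt i.pos one_pos⟩
    else c ⟨(i : ℕ) - 1, (Nat.sub_le _ _).trans_lt i.isLt⟩

/-- A linear code of length `n + n`, whose words are written as concatenations `(c, c')` of two
words of length `n`, is 2-quasi `lam`-constacyclic if it is invariant under the double
`lam`-constacyclic permutation. -/
def IsTwoQuasiConstacyclic {F : Type*} [Field F] (lam : F) {n : ℕ}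
    (C : Submodule F (Fin (n + n) → F)) : Prop :=
  ∀ c c' : Fin n → F, Fin.append c c' ∈ C →
    Fin.append (constaShift lam c) (constaShift lam c') ∈ C

/-- Linear codes over `F` of arbitrary length: a length together with a code of that length. -/
abbrev LinearCode (F : Type*) [Field F] := Σ N : ℕ, Submodule F (Fin N → F)

/-- A sequence of linear codes is asymptotically good if the lengths go to infinity and the rates
and the relative minimum distances all exceed one positive real number. -/
def IsGoodSequence {F : Type*} [Field F] [DecidableEq F] (C : ℕ → LinearCode F) : Prop :=
  Tendsto (fun i => (C i).1) atTop atTop ∧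
    ∃ δ : ℝ, 0 < δ ∧ ∀ i, δ < rate (C i).2 ∧ δ < relMinDist (C i).2

/-- A class of linear codes is asymptotically good if it contains an asymptotically good
sequence; otherwise it is asymptotically bad. -/
def AsymptoticallyGood {F : Type*} [Field F] [DecidableEq F] (P : Set (LinearCode F)) : Prop :=
  ∃ C : ℕ → LinearCode F, (∀ i, C i ∈ P) ∧ IsGoodSequence C

/-- The class of self-dual 2-quasi `lam`-constacyclic codes over `F`, of all lengths `2n`,
`n ≥ 1`. -/
def selfDualTwoQuasi (F : Type*) [Field F] (lam : F) : Set (LinearCode F) :=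
  {C | ∃ n : ℕ, 0 < n ∧ ∃ D : Submodule F (Fin (n + n) → F),
    IsTwoQuasiConstacyclic lam D ∧ IsSelfDual D ∧ C = ⟨n + n, D⟩}

end TwoQuasi

/-!
**Only if.** A self-dual code `C` that is invariant under the double `lam`-constacyclic shift
`T lam` is also invariant under `T lam⁻¹`, because `⟨T lam a, T lam⁻¹ b⟩ = ⟨a, b⟩` and `T lam`
permutes `C` (`IsTwoQuasiConstacyclic.inv_of_isSelfDual`). If `lam ^ 2 ≠ 1`, then
`T lam c - T lam⁻¹ c` has weight at most two and is nonzero for a suitable codeword `c`, so the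
minimum distance is at most two (`minDist_le_two_of_isSelfDual`).

**If.** Let `p` be the characteristic, `q` the order of `F`, `n = p ^ k`, and
`R = F[X] / (X ^ n - 1)` with the involution `bar : X ↦ X⁻¹`. For `lam = ± 1` we have
`lam ^ n = lam`, so scaling the `i`-th coordinates by `lam ^ i` turns cyclic codes into
`lam`-constacyclic ones, and the double circulant code `{(a, a * b)}` with `b * bar b = -1` becomes a
self-dual 2-quasi `lam`-constacyclic code of rate `1 / 2`. Since `q` is not `3` modulo `4`, there is
`e : F` with `e * e = -1`, and `b = e • v / bar v` is admissible for every unit `v`. A counting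
argument shows that some `v` yields a code of large distance, from three ingredients.

* For fixed `(s, t)`, the quotients of two units `v` whose codes contain `(s, t)` lie in the kernel
  of `w ↦ s * (w - bar w)`. This map has rank at least `m / 2 - 1`, where `m` is the dimension of the
  ideal of `s`: modulo two dimensions, that ideal is `s * (X - X⁻¹) * R`, and `R = R₀ + X * R₀` for
  the subalgebra `R₀` of fixed elements (`finrank_span_singleton_le`, `sq_card_solutions_mul_le`).
* `X - 1` is nilpotent in `R`, so `m ≤ p ^ j` implies `(X - 1) ^ p ^ j * s = 0`, that is, `s` has
  period `p ^ j` (`CyclicAlgebra.single_mul_eq_self`). A light word with `p ^ i < m ≤ p ^ (i + 1)`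
  is therefore a repetition of a light word of length `p ^ (i + 1)`
  (`exists_periodic_eq_of_light`).
* Light words of length `N` number at most `A ^ N` with `A` close to `1`
  (`exists_card_hammingBall_le`).

Summing over `i`, the units excluded by light words number at most a constant times
`q ^ n * ∑ r ^ i` with `r < 1`, where only large `i` occur because a nonzero word of short period is
not light (`card_augmentation_eq_one_le`). This is less than `q ^ (n - 1)`, which bounds from below
the number of elements of augmentation one, all of them units.
-/

namespace TwoQuasi

/-! ### The constacyclic shift and minimum distances -/

section Words

variable {F : Type*} [Field F]

lemma constaShift_zero (lam : F) {m : ℕ} (c : Fin (m + 1) → F) :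
    constaShift lam c 0 = lam * c (Fin.last m) := by
  simp [constaShift, Fin.last]

lemma constaShift_succ (lam : F) {m : ℕ} (c : Fin (m + 1) → F) (i : Fin m) :
    constaShift lam c i.succ = c i.castSucc := by
  simp [constaShift, Fin.castSucc, Fin.castAdd, Fin.castLE]

/-- The `lam`- and `mu`-constacyclic permutations are inverse transposes of each other when
`lam * mu = 1`. -/
lemma sum_constaShift_mul_constaShift {lam mu : F} (h : lam * mu = 1) {n : ℕ} (a b : Fin n → F) :
    ∑ i, constaShift lam a i * constaShift mu b i = ∑ i, a i * b i := by
  cases n with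
  | zero => simp
  | succ m =>
    rw [Fin.sum_univ_succ, Fin.sum_univ_castSucc]
    simp only [constaShift_zero, constaShift_succ]
    linear_combination (a (Fin.last m) * b (Fin.last m)) * h

lemma constaShift_injective {lam : F} (h : lam ≠ 0) {n : ℕ} :
    Function.Injective (constaShift lam : (Fin n → F) → Fin n → F) := by
  cases n with
  | zero => intro a b _; exact Subsingleton.elim _ _
  | succ m =>
    intro a b hab
    ext i
    refine Fin.lastCases ?_ (fun i => ?_) i
    · have := congrFun hab 0
      simpa [constaShift_zero, h] using this
    · have := congrFun hab i.succ
      simpa [constaShift_succ] using this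

lemma sum_append_mul_append {n : ℕ} (a a' b b' : Fin n → F) :
    ∑ i, Fin.append a a' i * Fin.append b b' i = ∑ i, a i * b i + ∑ i, a' i * b' i := by
  simp [Fin.sum_univ_add, -Fin.natAdd_eq_addNat]

/-- A self-dual code that is invariant under the double `lam`-constacyclic permutation is also
invariant under the double `lam⁻¹`-constacyclic permutation. -/
lemma IsTwoQuasiConstacyclic.inv_of_isSelfDual [Finite F] {lam : F} (hlam : lam ≠ 0) {n : ℕ}
    {C : Submodule F (Fin (n + n) → F)} (hC : IsTwoQuasiConstacyclic lam C) (hd : IsSelfDual C) :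
    IsTwoQuasiConstacyclic lam⁻¹ C := by
  intro b b' hb
  -- The shift permutes the finite set of codewords, so every codeword is a shifted codeword.
  let f : {w : (Fin n → F) × (Fin n → F) // Fin.append w.1 w.2 ∈ C} →
      {w : (Fin n → F) × (Fin n → F) // Fin.append w.1 w.2 ∈ C} :=
    fun w => ⟨(constaShift lam w.1.1, constaShift lam w.1.2), hC _ _ w.2⟩
  have hf : Function.Injective f := by
    rintro ⟨⟨u, u'⟩, hu⟩ ⟨⟨v, v'⟩, hv⟩ huv
    simp only [f, Subtype.mk.injEq, Prod.mk.injEq] at huv ⊢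
    exact ⟨constaShift_injective hlam huv.1, constaShift_injective hlam huv.2⟩
  have hs := Finite.surjective_of_injective hf
  rw [hd]
  intro c hc
  rw [← Fin.append_castAdd_natAdd (f := c)] at hc ⊢
  obtain ⟨⟨⟨a, a'⟩, ha⟩, hac⟩ := hs ⟨(_, _), hc⟩
  simp only [f, Subtype.mk.injEq, Prod.mk.injEq] at hac
  rw [← hac.1, ← hac.2, sum_append_mul_append,
    sum_constaShift_mul_constaShift (mul_inv_cancel₀ hlam),
    sum_constaShift_mul_constaShift (mul_inv_cancel₀ hlam), ← sum_append_mul_append]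
  rw [hd] at hb
  exact hb _ ha

/-- If every word of a shift-invariant code vanishes at the last place of both halves, then the
code is zero. -/
lemma IsTwoQuasiConstacyclic.eq_zero_of_last_eq_zero {lam : F} {m : ℕ}
    {C : Submodule F (Fin ((m + 1) + (m + 1)) → F)} (hC : IsTwoQuasiConstacyclic lam C)
    (h : ∀ c c' : Fin (m + 1) → F, Fin.append c c' ∈ C → c (Fin.last m) = 0 ∧ c' (Fin.last m) = 0) :
    C = ⊥ := by
  have key : ∀ i : Fin (m + 1), ∀ c c' : Fin (m + 1) → F, Fin.append c c' ∈ C →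
      c i = 0 ∧ c' i = 0 := by
    intro i
    induction i using Fin.reverseInduction with
    | last => exact h
    | cast i ih =>
      intro c c' hc
      simpa [constaShift_succ] using ih _ _ (hC c c' hc)
  rw [eq_bot_iff]
  intro c hc
  rw [← Fin.append_castAdd_natAdd (f := c)] at hc
  rw [Submodule.mem_bot]
  ext i
  refine Fin.addCases (fun i => ?_) (fun i => ?_) i
  · exact (key i _ _ hc).1
  · exact (key i _ _ hc).2

variable [DecidableEq F]

lemma minDist_le_hammingNorm {N : ℕ} {C : Submodule F (Fin N → F)} {c : Fin N → F}
    (hc : c ∈ C) (h0 : c ≠ 0) : minDist C ≤ hammingNorm c :=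
  Nat.sInf_le ⟨c, hc, 0, C.zero_mem, h0, (hammingDist_zero_right c).symm⟩

lemma exists_minDist_eq_hammingNorm {N : ℕ} {C : Submodule F (Fin N → F)} (hC : C ≠ ⊥) :
    ∃ c ∈ C, c ≠ 0 ∧ minDist C = hammingNorm c := by
  obtain ⟨c, hc, h0⟩ := Submodule.exists_mem_ne_zero_of_ne_bot hC
  have hne : {d : ℕ | ∃ c ∈ C, ∃ c' ∈ C, c ≠ c' ∧ d = hammingDist c c'}.Nonempty :=
    ⟨_, c, hc, 0, C.zero_mem, h0, rfl⟩
  obtain ⟨a, ha, b, hb, hab, hd⟩ := Nat.sInf_mem hne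
  exact ⟨-a + b, C.add_mem (C.neg_mem ha) hb, mt neg_add_eq_zero.1 hab,
    hd.trans (hammingDist_eq_hammingNorm a b)⟩

/-- For `lam ^ 2 ≠ 1`, the difference of the `lam`- and `lam⁻¹`-constacyclic permutations maps
every word to a word supported on the first places of the two halves. -/
lemma minDist_le_two_of_isSelfDual [Finite F] {lam : F} (hlam : lam ≠ 0) (hsq : lam ^ 2 ≠ 1) {n : ℕ}
    {C : Submodule F (Fin (n + n) → F)} (hC : IsTwoQuasiConstacyclic lam C) (hd : IsSelfDual C)
    (hbot : C ≠ ⊥) : minDist C ≤ 2 := by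
  cases n with
  | zero => exact absurd ((Submodule.eq_bot_iff C).2 fun x _ => funext fun i => i.elim0) hbot
  | succ m =>
    have hC' := hC.inv_of_isSelfDual hlam hd
    have hne : lam - lam⁻¹ ≠ 0 := by
      intro h
      apply hsq
      field_simp at h
      linear_combination h
    by_contra hlt
    refine hbot (hC.eq_zero_of_last_eq_zero fun c c' hc => ?_)
    set w := Fin.append (constaShift lam c) (constaShift lam c') -
      Fin.append (constaShift lam⁻¹ c) (constaShift lam⁻¹ c') with hw
    have hwC : w ∈ C := C.sub_mem (hC c c' hc) (hC' c c' hc)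
    have hsupp : hammingNorm w ≤ 2 := by
      refine (Finset.card_le_card (t := {Fin.castAdd (m + 1) 0, Fin.natAdd (m + 1) 0}) ?_).trans
        Finset.card_le_two
      intro i
      refine Fin.addCases (fun i => ?_) (fun i => ?_) i <;>
        refine Fin.cases ?_ (fun i => ?_) i <;> simp [hw, constaShift_succ, -Fin.natAdd_eq_addNat]
    have hw0 : w = 0 := by
      by_contra h0
      exact hlt ((minDist_le_hammingNorm hwC h0).trans hsupp)
    constructor
    · have h := congrFun hw0 (Fin.castAdd (m + 1) 0)
      simp only [hw, Pi.sub_apply, Fin.append_left, constaShift_zero, Pi.zero_apply, ← sub_mul] at h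
      exact (mul_eq_zero.1 h).resolve_left hne
    · have h := congrFun hw0 (Fin.natAdd (m + 1) 0)
      simp only [hw, Pi.sub_apply, Fin.append_right, constaShift_zero, Pi.zero_apply,
        ← sub_mul] at h
      exact (mul_eq_zero.1 h).resolve_left hne

lemma sq_eq_one_of_asymptoticallyGood [Finite F] {lam : F} (hlam : lam ≠ 0)
    (h : AsymptoticallyGood (selfDualTwoQuasi F lam)) : lam ^ 2 = 1 := by
  by_contra hsq
  obtain ⟨C, hC, hlim, δ, hδ, hgood⟩ := h
  obtain ⟨i, hi⟩ := (hlim.eventually_ge_atTop (⌈2 / δ⌉₊ + 1)).exists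
  obtain ⟨n, hn, D, hD, hd, hCi⟩ := hC i
  have hr := hgood i
  rw [hCi] at hr hi
  simp only at hr hi
  have hbot : D ≠ ⊥ := by
    rintro rfl
    have := hr.1
    simp only [rate, finrank_bot, Nat.cast_zero, zero_div] at this
    exact absurd this hδ.not_gt
  have h2 : ((minDist D : ℕ) : ℝ) ≤ 2 := by
    exact_mod_cast minDist_le_two_of_isSelfDual hlam hsq hD hd hbot
  have hN : 2 / δ < ((n + n : ℕ) : ℝ) :=
    (Nat.le_ceil _).trans_lt (by exact_mod_cast hi)
  have hpos : (0 : ℝ) < ((n + n : ℕ) : ℝ) := (by positivity : (0 : ℝ) < 2 / δ).trans hN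
  have h3 := hr.2
  rw [relMinDist, lt_div_iff₀ hpos] at h3
  rw [div_lt_iff₀ hδ] at hN
  linarith

end Words

/-! ### Algebras generated by one element inverted by an involution -/

section Generated

variable {F A : Type*} [Field F] [CommRing A] [Algebra F A]

lemma mem_of_adjoin_singleton_eq_top {x : A} (hx : Algebra.adjoin F {x} = ⊤) (P : Submodule F A)
    (h1 : 1 ∈ P) (hmul : ∀ a ∈ P, x * a ∈ P) (a : A) : a ∈ P := by
  have ha : a ∈ Algebra.adjoin F {x} := hx ▸ Algebra.mem_top
  rw [Algebra.adjoin_singleton_eq_range_aeval] at ha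
  obtain ⟨p, rfl⟩ := ha
  have hpow : ∀ k : ℕ, x ^ k ∈ P := by
    intro k
    induction k with
    | zero => simpa using h1
    | succ k ih => simpa [pow_succ'] using hmul _ ih
  rw [AlgHom.toRingHom_eq_coe, RingHom.coe_coe, Polynomial.aeval_eq_sum_range]
  exact P.sum_mem fun k _ => P.smul_mem _ (hpow k)

/-- The `F`-linear map `w ↦ s * (w - bar w)`. -/
def skewMap (bar : A →ₐ[F] A) (s : A) : A →ₗ[F] A :=
  LinearMap.mulLeft F s ∘ₗ (LinearMap.id - bar.toLinearMap)

@[simp] lemma skewMap_apply (bar : A →ₐ[F] A) (s w : A) : skewMap bar s w = s * (w - bar w) := rfl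

variable {bar : A →ₐ[F] A} {x : A}

lemma bar_bar_generator (hbar : bar x * x = 1) : bar (bar x) = x := by
  have h : bar (bar x) * bar x = 1 := by rw [← map_mul, hbar, map_one]
  linear_combination x * h - bar (bar x) * hbar

/-- Every element is `w₁ + x * w₂` with `w₁` and `w₂` fixed by the involution. -/
lemma exists_fixed_add_mul_fixed (hx : Algebra.adjoin F {x} = ⊤) (hbar : bar x * x = 1) (a : A) :
    ∃ w₁ w₂ : A, bar w₁ = w₁ ∧ bar w₂ = w₂ ∧ a = w₁ + x * w₂ := by
  let S : Submodule F A := LinearMap.ker (LinearMap.id - bar.toLinearMap)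
  have hS : ∀ w, w ∈ S ↔ bar w = w := fun w => by
    rw [LinearMap.mem_ker, LinearMap.sub_apply, sub_eq_zero, eq_comm]; rfl
  have hbb := bar_bar_generator hbar
  have := mem_of_adjoin_singleton_eq_top hx (S ⊔ S.map (LinearMap.mulLeft F x)) ?_ ?_ a
  · obtain ⟨w₁, h₁, _, ⟨w₂, h₂, rfl⟩, rfl⟩ := Submodule.mem_sup.1 this
    exact ⟨w₁, w₂, (hS _).1 h₁, (hS _).1 h₂, rfl⟩
  · exact Submodule.mem_sup_left ((hS 1).2 (map_one bar))
  · intro b hb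
    obtain ⟨w₁, h₁, _, ⟨w₂, h₂, rfl⟩, rfl⟩ := Submodule.mem_sup.1 hb
    rw [SetLike.mem_coe] at h₂
    rw [hS] at h₁ h₂
    -- `x` is a root of `X ^ 2 - (x + bar x) * X + 1`, whose coefficients are fixed.
    refine Submodule.mem_sup.2 ⟨-w₂, ?_, _, ⟨w₁ + (x + bar x) * w₂, ?_, rfl⟩, ?_⟩
    · rw [hS, map_neg, h₂]
    · rw [SetLike.mem_coe, hS, map_add, map_mul, map_add, h₁, h₂, hbb]
      ring
    · simp only [LinearMap.mulLeft_apply]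
      linear_combination w₂ * hbar

/-- Every element is an `F`-combination of `1` and `x` modulo `x - bar x`. -/
lemma exists_mul_add_smul_one_add_smul (hx : Algebra.adjoin F {x} = ⊤) (hbar : bar x * x = 1)
    (a : A) : ∃ (b : A) (c d : F), a = (x - bar x) * b + c • 1 + d • x := by
  have := mem_of_adjoin_singleton_eq_top hx
    (LinearMap.range (LinearMap.mulLeft F (x - bar x)) ⊔ Submodule.span F {1, x}) ?_ ?_ a
  · obtain ⟨_, ⟨b, rfl⟩, z, hz, rfl⟩ := Submodule.mem_sup.1 this
    obtain ⟨c, d, rfl⟩ := Submodule.mem_span_pair.1 hz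
    exact ⟨b, c, d, by simp [add_assoc]⟩
  · exact Submodule.mem_sup_right (Submodule.subset_span (by simp))
  · intro e he
    obtain ⟨_, ⟨b, rfl⟩, z, hz, rfl⟩ := Submodule.mem_sup.1 he
    obtain ⟨c, d, rfl⟩ := Submodule.mem_span_pair.1 hz
    refine Submodule.mem_sup.2 ⟨_, ⟨x * b + d • x, rfl⟩, d • 1 + c • x,
      Submodule.mem_span_pair.2 ⟨d, c, rfl⟩, ?_⟩
    simp only [LinearMap.mulLeft_apply, Algebra.smul_def]
    linear_combination -(algebraMap F A d) * hbar

variable [Module.Finite F A]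

/-- The rank bound behind the counting argument: the map `w ↦ s * (w - bar w)` has rank at least
about half the dimension of the ideal generated by `s`. -/
lemma finrank_span_singleton_le (hx : Algebra.adjoin F {x} = ⊤) (hbar : bar x * x = 1) (s : A) :
    Module.finrank F (Ideal.span {s}) ≤
      2 * Module.finrank F (LinearMap.range (skewMap bar s)) + 2 := by
  set W := LinearMap.range (skewMap bar s) with hW
  have hle : (Ideal.span {s}).restrictScalars F ≤
      (W ⊔ W.map (LinearMap.mulLeft F x)) ⊔ Submodule.span F ({s, s * x} : Set A) := by
    intro z hz
    obtain ⟨a, rfl⟩ := Ideal.mem_span_singleton'.1 hz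
    obtain ⟨b, c, d, rfl⟩ := exists_mul_add_smul_one_add_smul hx hbar a
    obtain ⟨w₁, w₂, h₁, h₂, rfl⟩ := exists_fixed_add_mul_fixed hx hbar b
    refine Submodule.mem_sup.2 ⟨_, Submodule.mem_sup.2 ⟨skewMap bar s (x * w₁), ⟨_, rfl⟩, _,
      ⟨skewMap bar s (x * w₂), ⟨_, rfl⟩, rfl⟩, rfl⟩, _,
      Submodule.mem_span_pair.2 ⟨c, d, rfl⟩, ?_⟩
    simp only [skewMap_apply, LinearMap.mulLeft_apply, map_mul, h₁, h₂, Algebra.smul_def]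
    ring
  have h1 := Submodule.finrank_mono hle
  have h2 := Submodule.finrank_add_le_finrank_add_finrank
    (W ⊔ W.map (LinearMap.mulLeft F x)) (Submodule.span F ({s, s * x} : Set A))
  have h3 := Submodule.finrank_add_le_finrank_add_finrank W (W.map (LinearMap.mulLeft F x))
  have h4 : Module.finrank F (W.map (LinearMap.mulLeft F x)) ≤ Module.finrank F W :=
    Submodule.finrank_map_le _ _
  have h5 : Module.finrank F (Submodule.span F ({s, s * x} : Set A)) ≤ 2 := by
    classical
    have := finrank_span_finset_le_card (R := F) ({s, s * x} : Finset A)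
    rw [Set.finrank, Finset.coe_pair] at this
    exact this.trans Finset.card_le_two
  have h6 : Module.finrank F (Ideal.span {s}) =
    Module.finrank F ((Ideal.span {s}).restrictScalars F) := rfl
  omega

omit [Module.Finite F A] in
/-- If `v₀` solves `e • (s * v) = t * bar v`, then every solution is a multiple `w * v₀` with
`s * (w - bar w) = 0`. -/
lemma skewMap_mul_inv_eq_zero {e : F} (he : e ≠ 0) {s t v v₀ : A} (hv₀ : IsUnit v₀)
    (h : e • (s * v) = t * bar v) (h₀ : e • (s * v₀) = t * bar v₀) :
    skewMap bar s (v * ↑hv₀.unit⁻¹) = 0 := by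
  have hval : (hv₀.unit : A) = v₀ := hv₀.unit_spec
  generalize hv₀.unit = u at hval ⊢
  subst hval
  have hu : (u : A) * ((u⁻¹ : Aˣ) : A) = 1 := Units.mul_inv u
  have hbu : bar u * bar ((u⁻¹ : Aˣ) : A) = 1 := by rw [← map_mul, hu, map_one]
  have key : s * v * bar u = s * u * bar v := by
    have : e • (s * v * bar u) = e • (s * u * bar v) := by
      rw [← smul_mul_assoc, h, ← smul_mul_assoc, h₀]
      ring
    exact (IsUnit.mk0 e he).smul_left_cancel.1 this
  have hunit : IsUnit ((u : A) * bar u) := u.isUnit.mul (u.isUnit.map bar)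
  simp only [skewMap_apply, map_mul]
  rw [← hunit.mul_right_eq_zero]
  linear_combination key + (s * v * bar u) * hu - (s * u * bar v) * hbu

variable [Finite F]

/-- The number of units `v` such that `(s, t)` lies in the code attached to `v` is at most
`q ^ (n + 1 - m / 2)`, where `n = dim A` and `m` is the dimension of the ideal of `s`. -/
lemma sq_card_solutions_mul_le (hx : Algebra.adjoin F {x} = ⊤) (hbar : bar x * x = 1)
    {e : F} (he : e ≠ 0) (s t : A) :
    Nat.card {v : A // IsUnit v ∧ e • (s * v) = t * bar v} ^ 2 *
      Nat.card F ^ Module.finrank F (Ideal.span {s}) ≤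
        Nat.card F ^ (2 * Module.finrank F A + 2) := by
  have hA : Finite A := Module.finite_of_finite F
  have hcard : Nat.card {v : A // IsUnit v ∧ e • (s * v) = t * bar v} ≤
      Nat.card F ^ Module.finrank F (LinearMap.ker (skewMap bar s)) := by
    rcases isEmpty_or_nonempty {v : A // IsUnit v ∧ e • (s * v) = t * bar v} with hE | ⟨⟨v₀, hu, h₀⟩⟩
    · simp
    · rw [← Module.natCard_eq_pow_finrank]
      refine Nat.card_le_card_of_injective
        (fun v => ⟨v.1 * ↑hu.unit⁻¹, skewMap_mul_inv_eq_zero he hu v.2.2 h₀⟩) ?_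
      intro v w hvw
      simpa [Subtype.ext_iff] using hvw
  have hrank := LinearMap.finrank_range_add_finrank_ker (skewMap bar s)
  have hle := finrank_span_singleton_le hx hbar s
  calc _ ≤ (Nat.card F ^ Module.finrank F (LinearMap.ker (skewMap bar s))) ^ 2 *
        Nat.card F ^ (2 * Module.finrank F (LinearMap.range (skewMap bar s)) + 2) :=
        Nat.mul_le_mul (Nat.pow_le_pow_left hcard 2) (Nat.pow_le_pow_right Nat.card_pos hle)
    _ = _ := by
        rw [← pow_mul, ← pow_add]
        congr 1
        omega

omit [Finite F] in
/-- A nilpotent element is killed, on a principal ideal, by the power given by the dimension. -/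
lemma pow_mul_eq_zero_of_finrank_span_le {y s : A} (hy : IsNilpotent y) {d : ℕ}
    (hd : Module.finrank F (Ideal.span {s}) ≤ d) : y ^ d * s = 0 := by
  let φ : A →ₐ[F] Module.End F (Ideal.span {s}) := Algebra.lsmul F F (Ideal.span {s})
  have hφ : IsNilpotent (φ y) := hy.map φ
  have h0 : φ y ^ Module.finrank F (Ideal.span {s}) = 0 := by
    have := LinearMap.aeval_self_charpoly (φ y)
    rwa [hφ.charpoly_eq_X_pow_finrank, map_pow, Polynomial.aeval_X] at this
  have h1 : φ (y ^ d) = 0 := by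
    rw [map_pow]
    exact pow_eq_zero_of_le hd h0
  have := congrArg Subtype.val (LinearMap.congr_fun h1 ⟨s, Ideal.mem_span_singleton_self s⟩)
  exact this

omit [Module.Finite F A] [Finite F] in
lemma isUnit_of_augmentation_eq_one (hx : Algebra.adjoin F {x} = ⊤) (hnil : IsNilpotent (x - 1))
    (aug : A →ₐ[F] F) {v : A} (hv : aug v = 1) : IsUnit v := by
  have haug : aug x = 1 := by
    have := (hnil.map aug).eq_zero
    rwa [map_sub, map_one, sub_eq_zero] at this
  have key : ∀ a : A, a - algebraMap F A (aug a) ∈ nilradical A := by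
    intro a
    refine mem_of_adjoin_singleton_eq_top hx
      (((nilradical A).restrictScalars F).comap
        (LinearMap.id - (Algebra.linearMap F A) ∘ₗ aug.toLinearMap)) ?_ ?_ a
    · simp
    · intro b hb
      simp only [Submodule.mem_comap, LinearMap.sub_apply, LinearMap.id_apply,
        LinearMap.comp_apply, AlgHom.toLinearMap_apply, Algebra.linearMap_apply,
        Submodule.restrictScalars_mem, map_mul, haug, one_mul] at hb ⊢
      have : x * b - algebraMap F A (aug b) = (b - algebraMap F A (aug b)) + b * (x - 1) := by ring
      rw [this]
      exact Ideal.add_mem _ hb (Ideal.mul_mem_left _ _ hnil)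
  have := IsNilpotent.isUnit_add_one (mem_nilradical.1 (key v))
  simpa [hv] using this

omit [Module.Finite F A] [Finite F] in
lemma card_le_card_augmentation_eq_one_mul [Finite A] [Finite F] (aug : A →ₐ[F] F) :
    Nat.card A ≤ Nat.card {v : A // aug v = 1} * Nat.card F := by
  rw [← Nat.card_prod]
  refine Nat.card_le_card_of_injective
    (fun a => (⟨a + algebraMap F A (1 - aug a), by simp⟩, aug a)) ?_
  intro a b hab
  simp only [Prod.mk.injEq, Subtype.mk.injEq] at hab
  rw [hab.2] at hab
  exact add_right_cancel hab.1

end Generated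

/-! ### Hamming balls and pullbacks of words -/

section HammingBall

/-- Chernoff-type estimate: the number of words of weight at most `δ * N` over a fixed alphabet
grows with an exponential rate `A` that can be made as close to `1` as desired. -/
lemma exists_card_hammingBall_le (G : Type*) [Fintype G] [DecidableEq G] [Zero G] {A : ℝ}
    (hA : 1 < A) : ∃ δ : ℝ, 0 < δ ∧ ∀ (ι : Type) [Fintype ι],
      (Nat.card {h : ι → G // (hammingNorm h : ℝ) ≤ δ * Fintype.card ι} : ℝ) ≤
        A ^ Fintype.card ι := by
  classical
  set B := √A with hBdef
  have hB : 1 < B := Real.lt_sqrt_of_sq_lt (by simpa using hA)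
  have hBA : B * B = A := Real.mul_self_sqrt (by linarith)
  set g : ℝ := (Fintype.card G : ℝ) with hg
  have hg1 : 1 ≤ g := by
    have : 0 < Fintype.card G := Fintype.card_pos_iff.2 ⟨0⟩
    rw [hg]
    exact_mod_cast this
  -- The weight `z` per nonzero letter keeps the generating function `1 + g * z` below `B`.
  set z : ℝ := (B - 1) / (g * B) with hz
  have hz0 : 0 < z := div_pos (by linarith) (by positivity)
  have hgz : 1 + g * z ≤ B := by
    have : g * z = (B - 1) / B := by rw [hz]; field_simp
    rw [this, div_eq_mul_inv]
    have : B⁻¹ ≤ 1 := inv_le_one_of_one_le₀ hB.le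
    nlinarith
  have hz1 : z < 1 := by
    rw [hz, div_lt_one (by positivity)]
    nlinarith
  have hlogz : Real.log z < 0 := Real.log_neg hz0 hz1
  have hlogB : 0 < Real.log B := Real.log_pos hB
  refine ⟨Real.log B / -Real.log z, div_pos hlogB (by linarith), fun ι _ => ?_⟩
  set N := Fintype.card ι with hN
  have hword : ∀ h : ι → G, (hammingNorm h : ℝ) ≤ Real.log B / -Real.log z * N →
      1 ≤ B ^ N * z ^ hammingNorm h := by
    intro h hh
    rw [div_mul_eq_mul_div, le_div_iff₀ (by linarith)] at hh
    rw [← Real.log_nonneg_iff (by positivity), Real.log_mul (by positivity) (by positivity),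
      Real.log_pow, Real.log_pow]
    linarith
  have hsum : ∑ h : ι → G, z ^ hammingNorm h = (∑ a : G, if a = 0 then 1 else z) ^ N := by
    rw [hN, ← Finset.card_univ, ← Finset.prod_const, Finset.prod_univ_sum]
    refine Finset.sum_congr (by simp) fun h _ => ?_
    rw [Finset.prod_ite]
    simp [hammingNorm]
  have hletter : ∑ a : G, (if a = 0 then 1 else z) ≤ B := by
    refine le_trans ?_ hgz
    calc ∑ a : G, (if a = 0 then 1 else z) ≤ ∑ a : G, ((if a = 0 then 1 else 0) + z) :=
          Finset.sum_le_sum fun a _ => by split_ifs <;> simp [hz0.le]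
      _ = 1 + g * z := by simp [Finset.sum_add_distrib, hg]
  have hletter0 : 0 ≤ ∑ a : G, (if a = 0 then 1 else z) :=
    Finset.sum_nonneg fun a _ => by split_ifs <;> simp [hz0.le]
  rw [Nat.card_eq_fintype_card, Fintype.card_subtype]
  calc ((Finset.univ.filter fun h : ι → G =>
        (hammingNorm h : ℝ) ≤ Real.log B / -Real.log z * N).card : ℝ)
      = ∑ h : ι → G with (hammingNorm h : ℝ) ≤ Real.log B / -Real.log z * N, (1 : ℝ) := by simp
    _ ≤ ∑ h : ι → G with (hammingNorm h : ℝ) ≤ Real.log B / -Real.log z * N,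
          B ^ N * z ^ hammingNorm h :=
        Finset.sum_le_sum fun h hh => hword h (Finset.mem_filter.1 hh).2
    _ ≤ ∑ h : ι → G, B ^ N * z ^ hammingNorm h :=
        Finset.sum_le_sum_of_subset_of_nonneg (Finset.filter_subset _ _)
          fun h _ _ => by positivity
    _ = B ^ N * (∑ a : G, if a = 0 then 1 else z) ^ N := by rw [← Finset.mul_sum, hsum]
    _ ≤ B ^ N * B ^ N := by gcongr
    _ = A ^ N := by rw [← mul_pow, hBA]

/-- Pulling a word back along `ZMod n → ZMod m` multiplies its weight by `n / m`. -/
lemma hammingNorm_comp_castHom {G : Type*} [DecidableEq G] [Zero G] {m n : ℕ} [NeZero m] [NeZero n]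
    (hmn : m ∣ n) (h : ZMod m → G) :
    m * hammingNorm (h ∘ ZMod.castHom hmn (ZMod m)) = n * hammingNorm h := by
  classical
  set π := ZMod.castHom hmn (ZMod m) with hπ
  have hsurj : Function.Surjective π := ZMod.castHom_surjective hmn
  set c := (Finset.univ.filter fun i => π i = 0).card with hc
  have hfib : ∀ r : ZMod m, (Finset.univ.filter fun i => π i = r).card = c := fun r =>
    AddMonoidHom.card_fiber_eq_of_mem_range π.toAddMonoidHom (hsurj r) (hsurj 0)
  have htot : n = m * c := by
    have := Finset.card_eq_sum_card_fiberwise (f := π) (s := Finset.univ) (t := Finset.univ)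
      (fun _ _ => Finset.mem_coe.2 (Finset.mem_univ _))
    simpa [hfib, ZMod.card] using this
  have hnorm : hammingNorm (h ∘ π) = hammingNorm h * c := by
    have := Finset.card_eq_sum_card_fiberwise (f := π)
      (s := Finset.univ.filter fun i => h (π i) ≠ 0) (t := Finset.univ.filter fun r => h r ≠ 0)
      (fun i hi => by simpa using hi)
    rw [hammingNorm]
    simp only [Function.comp_apply]
    rw [this, hammingNorm, Finset.card_eq_sum_ones, Finset.sum_mul]
    refine Finset.sum_congr rfl fun r hr => ?_
    rw [one_mul, ← hfib r, Finset.filter_filter]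
    congr 1
    ext i
    have := (Finset.mem_filter.1 hr).2
    simp only [Finset.mem_filter, Finset.mem_univ, true_and]
    exact ⟨fun h => h.2, fun h => ⟨h ▸ this, h⟩⟩
  calc m * hammingNorm (h ∘ π) = m * c * hammingNorm h := by rw [hnorm]; ring
    _ = n * hammingNorm h := by rw [← htot]

end HammingBall

/-! ### The group algebra of a finite cyclic group -/

section CyclicAlgebra

variable (F : Type*) [Field F] (n : ℕ)

/-- The group algebra `F[X] / (X ^ n - 1)` of the cyclic group of order `n`, whose ideals are the
cyclic codes of length `n`. -/
abbrev CyclicAlgebra := AddMonoidAlgebra F (ZMod n)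

namespace CyclicAlgebra

/-- The class of `X`. -/
noncomputable def gen : CyclicAlgebra F n := AddMonoidAlgebra.single 1 1

/-- The involution `X ↦ X⁻¹`. -/
noncomputable def bar : CyclicAlgebra F n →ₐ[F] CyclicAlgebra F n :=
  (AddMonoidAlgebra.domCongr F F (AddEquiv.neg (ZMod n))).toAlgHom

/-- The augmentation `X ↦ 1`, the sum of the coefficients. -/
noncomputable def aug : CyclicAlgebra F n →ₐ[F] F := AddMonoidAlgebra.lift F F (ZMod n) 1

variable {F n}

lemma coeff_bar (a : CyclicAlgebra F n) (i : ZMod n) : (bar F n a).coeff i = a.coeff (-i) := by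
  simp [bar]

lemma bar_bar (a : CyclicAlgebra F n) : bar F n (bar F n a) = a := by
  ext i
  simp [coeff_bar]

lemma gen_pow (k : ℕ) : gen F n ^ k = AddMonoidAlgebra.single (k : ZMod n) 1 := by
  simp [gen, AddMonoidAlgebra.single_pow]

lemma bar_gen_mul_gen : bar F n (gen F n) * gen F n = 1 := by
  simp [bar, gen, AddMonoidAlgebra.one_def]

lemma coeff_single_mul (r : ZMod n) (a : CyclicAlgebra F n) (i : ZMod n) :
    (AddMonoidAlgebra.single r (1 : F) * a).coeff i = a.coeff (i - r) := by
  rw [AddMonoidAlgebra.coeff_single_mul_eq_mul_coeff (i - r), one_mul]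
  intro j _
  rw [eq_sub_iff_add_eq']

variable [NeZero n]

lemma adjoin_gen : Algebra.adjoin F {gen F n} = ⊤ := by
  rw [eq_top_iff]
  rintro a -
  induction a using AddMonoidAlgebra.induction_linear with
  | zero => exact zero_mem _
  | add a b ha hb => exact add_mem ha hb
  | single i r =>
    have : AddMonoidAlgebra.single i r = r • gen F n ^ i.val := by
      rw [gen_pow, ZMod.natCast_zmod_val, AddMonoidAlgebra.smul_single, smul_eq_mul, mul_one]
    rw [this]
    exact Subalgebra.smul_mem _ (pow_mem (Algebra.self_mem_adjoin_singleton F _) _) r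

instance : Module.Finite F (CyclicAlgebra F n) :=
  Module.Finite.of_basis (AddMonoidAlgebra.basis (ZMod n) F)

lemma finrank_eq : Module.finrank F (CyclicAlgebra F n) = n := by
  rw [Module.finrank_eq_card_basis (AddMonoidAlgebra.basis (ZMod n) F), ZMod.card]

lemma sum_coeff_mul_coeff (a b : CyclicAlgebra F n) :
    ∑ i, a.coeff i * b.coeff i = (a * bar F n b).coeff 0 := by
  classical
  induction a using AddMonoidAlgebra.induction_linear with
  | zero => simp
  | add a a' ha ha' => simp [add_mul, Finset.sum_add_distrib, ha, ha']
  | single i r =>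
    rw [AddMonoidAlgebra.coeff_single_mul_eq_mul_coeff (-i), coeff_bar, neg_neg]
    · simp [Finsupp.single_apply]
    · intro j _
      rw [eq_neg_iff_add_eq_zero, add_comm]

omit [NeZero n] in
/-- The pairing `(a, z) ↦ (a * z).coeff 0` is nondegenerate. -/
lemma eq_zero_of_coeff_mul_eq_zero {z : CyclicAlgebra F n}
    (h : ∀ a : CyclicAlgebra F n, (a * z).coeff 0 = 0) : z = 0 := by
  ext i
  have := h (AddMonoidAlgebra.single (-i) 1)
  rw [coeff_single_mul] at this
  simpa using this

/-! ### Periods of words in cyclic codes of prime power length -/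

variable {p : ℕ} [Fact p.Prime] [CharP F p]

instance : CharP (CyclicAlgebra F n) p :=
  charP_of_injective_algebraMap (algebraMap F (CyclicAlgebra F n)).injective p

omit [NeZero n] in
lemma gen_sub_one_pow (j : ℕ) :
    (gen F n - 1) ^ p ^ j = AddMonoidAlgebra.single ((p ^ j : ℕ) : ZMod n) 1 - 1 := by
  rw [sub_pow_char_pow, one_pow, gen_pow]

omit [NeZero n] in
lemma isNilpotent_gen_sub_one {k : ℕ} (hn : n = p ^ k) : IsNilpotent (gen F n - 1) :=
  ⟨p ^ k, by rw [gen_sub_one_pow, ← hn, ZMod.natCast_self, ← AddMonoidAlgebra.one_def, sub_self]⟩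

/-- In length a power of the characteristic, the ideal of `X - 1` is nilpotent, so that a word
generating a cyclic code of dimension at most `p ^ j` is killed by `(X - 1) ^ p ^ j = X ^ p ^ j - 1`.
-/
lemma single_mul_eq_self {k j : ℕ} (hn : n = p ^ k) {s : CyclicAlgebra F n}
    (hs : Module.finrank F (Ideal.span {s}) ≤ p ^ j) :
    AddMonoidAlgebra.single ((p ^ j : ℕ) : ZMod n) 1 * s = s := by
  have := pow_mul_eq_zero_of_finrank_span_le (isNilpotent_gen_sub_one hn) hs
  rwa [gen_sub_one_pow, sub_mul, one_mul, sub_eq_zero] at this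

omit [Fact p.Prime] [CharP F p] in
/-- A word fixed by `X ^ m` with `m ∣ n` is pulled back from `ZMod m`. -/
lemma coeff_eq_of_single_mul_eq_self {m : ℕ} [NeZero m] (hmn : m ∣ n) {s : CyclicAlgebra F n}
    (hs : AddMonoidAlgebra.single (m : ZMod n) 1 * s = s) (i : ZMod n) :
    s.coeff i = s.coeff ((ZMod.castHom hmn (ZMod m) i).val : ZMod n) := by
  have hper : ∀ l : ℕ, ∀ r : ZMod n, s.coeff (r + (m : ZMod n) * l) = s.coeff r := by
    intro l
    induction l with
    | zero => simp
    | succ l ih =>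
      intro r
      rw [← ih r]
      conv_lhs => rw [← hs, coeff_single_mul]
      congr 1
      push_cast
      ring
  have hi : i = (((ZMod.castHom hmn (ZMod m) i).val : ℕ) : ZMod n) +
      (m : ZMod n) * ((i.val / m : ℕ) : ZMod n) := by
    have : (ZMod.castHom hmn (ZMod m) i).val = i.val % m := by
      rw [ZMod.castHom_apply, ZMod.cast_eq_val, ZMod.val_natCast]
    rw [this]
    have := Nat.mod_add_div i.val m
    calc i = ((i.val : ℕ) : ZMod n) := (ZMod.natCast_zmod_val i).symm
      _ = ((i.val % m + m * (i.val / m) : ℕ) : ZMod n) := by rw [this]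
      _ = _ := by push_cast; ring
  conv_lhs => rw [hi]
  exact hper _ _

end CyclicAlgebra

end CyclicAlgebra

/-! ### Double circulant codes -/

section DoubleCirculant

variable {F : Type*} [Field F] {n : ℕ}

/-- The coefficient word of an element of the cyclic algebra, with the `i`-th coefficient scaled by
`lam ^ i`. For `lam ^ n = lam` and `lam ^ 2 = 1` this turns cyclic codes isometrically into
`lam`-constacyclic codes. -/
noncomputable def word (lam : F) : CyclicAlgebra F n →ₗ[F] (Fin n → F) where
  toFun a i := lam ^ (i : ℕ) * a.coeff ((i : ℕ) : ZMod n)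
  map_add' a b := by ext i; simp [mul_add]
  map_smul' r a := by ext i; simp [mul_left_comm]

lemma word_apply (lam : F) (a : CyclicAlgebra F n) (i : Fin n) :
    word lam a i = lam ^ (i : ℕ) * a.coeff ((i : ℕ) : ZMod n) := rfl

/-- The double circulant code `{(a, a * b)}`, twisted by powers of `lam`. -/
noncomputable def doubleCirculant (lam : F) (b : CyclicAlgebra F n) :
    Submodule F (Fin (n + n) → F) :=
  LinearMap.range
    ({ toFun := fun a => Fin.append (word lam a) (word lam (a * b))
       map_add' := fun a a' => by
        ext i
        refine Fin.addCases (fun i => ?_) (fun i => ?_) i <;>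
          simp [add_mul, -Fin.natAdd_eq_addNat]
       map_smul' := fun r a => by
        ext i
        refine Fin.addCases (fun i => ?_) (fun i => ?_) i <;>
          simp [-Fin.natAdd_eq_addNat] } : CyclicAlgebra F n →ₗ[F] (Fin (n + n) → F))

lemma mem_doubleCirculant {lam : F} {b : CyclicAlgebra F n} {c : Fin (n + n) → F} :
    c ∈ doubleCirculant lam b ↔ ∃ a, Fin.append (word lam a) (word lam (a * b)) = c := Iff.rfl

lemma constaShift_word {lam : F} (hsq : lam ^ 2 = 1) (hpow : lam ^ n = lam)
    (a : CyclicAlgebra F n) :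
    constaShift lam (word lam a) = word lam (lam • (CyclicAlgebra.gen F n * a)) := by
  cases n with
  | zero => exact Subsingleton.elim _ _
  | succ m =>
    ext i
    refine Fin.cases ?_ (fun i => ?_) i
    · rw [constaShift_zero, word_apply, word_apply, AddMonoidAlgebra.coeff_smul_apply,
        CyclicAlgebra.gen, CyclicAlgebra.coeff_single_mul, ← mul_assoc, Fin.val_last, ← pow_succ',
        hpow]
      have : ((m : ℕ) : ZMod (m + 1)) = 0 - 1 := by
        have := ZMod.natCast_self (m + 1)
        push_cast at this
        linear_combination this
      simp [this]
    · rw [constaShift_succ, word_apply, word_apply, AddMonoidAlgebra.coeff_smul_apply,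
        CyclicAlgebra.gen, CyclicAlgebra.coeff_single_mul]
      simp only [Fin.val_castSucc, Fin.val_succ, Nat.cast_add, Nat.cast_one, add_sub_cancel_right,
        smul_eq_mul]
      linear_combination -(lam ^ (i : ℕ) * a.coeff ((i : ℕ) : ZMod (m + 1))) * hsq

lemma isTwoQuasiConstacyclic_doubleCirculant {lam : F} (hsq : lam ^ 2 = 1) (hpow : lam ^ n = lam)
    (b : CyclicAlgebra F n) : IsTwoQuasiConstacyclic lam (doubleCirculant lam b) := by
  rintro c c' ⟨a, ha⟩
  have h1 : word lam a = c := by ext i; simpa using congrFun ha (Fin.castAdd n i)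
  have h2 : word lam (a * b) = c' := by
    ext i
    simpa [-Fin.natAdd_eq_addNat] using congrFun ha (Fin.natAdd n i)
  refine mem_doubleCirculant.2 ⟨lam • (CyclicAlgebra.gen F n * a), ?_⟩
  rw [← h1, ← h2, constaShift_word hsq hpow, constaShift_word hsq hpow, smul_mul_assoc, mul_assoc]

variable [NeZero n]

/-- The residues `0, …, n - 1` modulo `n`. -/
noncomputable def residueEquiv (n : ℕ) [NeZero n] : Fin n ≃ ZMod n :=
  Equiv.ofBijective (fun i => ((i : ℕ) : ZMod n)) <| by
    rw [Fintype.bijective_iff_injective_and_card]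
    refine ⟨fun i j hij => Fin.ext ?_, by simp [ZMod.card]⟩
    have := congrArg ZMod.val hij
    simpa [ZMod.val_natCast, Nat.mod_eq_of_lt] using this

lemma residueEquiv_apply (i : Fin n) : residueEquiv n i = ((i : ℕ) : ZMod n) := rfl

lemma sum_word_mul_word {lam : F} (hsq : lam ^ 2 = 1) (a b : CyclicAlgebra F n) :
    ∑ i, word lam a i * word lam b i = (a * CyclicAlgebra.bar F n b).coeff 0 := by
  rw [← CyclicAlgebra.sum_coeff_mul_coeff, ← (residueEquiv n).sum_comp]
  refine Finset.sum_congr rfl fun i _ => ?_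
  rw [word_apply, word_apply, residueEquiv_apply]
  have : lam ^ (i : ℕ) * lam ^ (i : ℕ) = 1 := by rw [← mul_pow, ← sq, hsq, one_pow]
  linear_combination (a.coeff ((i : ℕ) : ZMod n) * b.coeff ((i : ℕ) : ZMod n)) * this

lemma word_surjective {lam : F} (hlam : lam ≠ 0) :
    Function.Surjective (word lam : CyclicAlgebra F n →ₗ[F] (Fin n → F)) := by
  intro c
  refine ⟨.ofCoeff (Finsupp.equivFunOnFinite.symm fun r =>
    (lam ^ ((residueEquiv n).symm r : ℕ))⁻¹ * c ((residueEquiv n).symm r)), ?_⟩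
  ext i
  rw [word_apply, ← residueEquiv_apply]
  simp [hlam]

lemma isSelfDual_doubleCirculant {lam : F} (hsq : lam ^ 2 = 1) {b : CyclicAlgebra F n}
    (hb : b * CyclicAlgebra.bar F n b = -1) : IsSelfDual (doubleCirculant lam b) := by
  have hlam : lam ≠ 0 := by rintro rfl; simp at hsq
  have hpair : ∀ a f g : CyclicAlgebra F n,
      ∑ i, Fin.append (word lam a) (word lam (a * b)) i * Fin.append (word lam f) (word lam g) i =
        (a * (CyclicAlgebra.bar F n f + b * CyclicAlgebra.bar F n g)).coeff 0 := by
    intro a f g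
    rw [sum_append_mul_append, sum_word_mul_word hsq, sum_word_mul_word hsq, mul_add, ← mul_assoc]
    rfl
  refine le_antisymm ?_ ?_
  · rintro _ ⟨f, rfl⟩ _ ⟨a, rfl⟩
    refine (hpair a f (f * b)).trans ?_
    rw [map_mul, mul_left_comm, hb]
    simp
  · intro c hc
    obtain ⟨f, hf⟩ := word_surjective (n := n) hlam fun i => c (Fin.castAdd n i)
    obtain ⟨g, hg⟩ := word_surjective (n := n) hlam fun i => c (Fin.natAdd n i)
    have hfg : Fin.append (word lam f) (word lam g) = c := by
      rw [hf, hg, Fin.append_castAdd_natAdd]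
    have hz := CyclicAlgebra.eq_zero_of_coeff_mul_eq_zero fun a => by
      rw [← hpair, hfg]
      exact hc _ (mem_doubleCirculant.2 ⟨a, rfl⟩)
    have hz' := congrArg (CyclicAlgebra.bar F n) hz
    rw [map_add, map_mul, CyclicAlgebra.bar_bar, CyclicAlgebra.bar_bar, map_zero] at hz'
    refine mem_doubleCirculant.2 ⟨f, ?_⟩
    rw [← hfg]
    congr 2
    linear_combination b * hz' - g * hb

lemma finrank_doubleCirculant {lam : F} (hlam : lam ≠ 0) (b : CyclicAlgebra F n) :
    Module.finrank F (doubleCirculant lam b) = n := by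
  rw [doubleCirculant, LinearMap.finrank_range_of_inj, CyclicAlgebra.finrank_eq]
  intro a a' haa
  have h : word lam a = word lam a' := by
    ext i
    simpa using congrFun haa (Fin.castAdd n i)
  ext r
  obtain ⟨i, rfl⟩ := (residueEquiv n).surjective r
  have := congrFun h i
  rw [word_apply, word_apply, ← residueEquiv_apply] at this
  exact mul_left_cancel₀ (pow_ne_zero _ hlam) this

variable [DecidableEq F]

/-- The number of places at which at least one of `s` and `t` has a nonzero coefficient. -/
noncomputable def pairWeight (s t : CyclicAlgebra F n) : ℕ :=
  hammingNorm fun i : ZMod n => (s.coeff i, t.coeff i)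

lemma pairWeight_le_hammingNorm {lam : F} (hlam : lam ≠ 0) (s t : CyclicAlgebra F n) :
    pairWeight s t ≤ hammingNorm (Fin.append (word lam s) (word lam t)) := by
  classical
  refine (Finset.card_le_card ?_).trans (Finset.card_image_le
    (f := fun i : Fin (n + n) => Fin.append (residueEquiv n) (residueEquiv n) i))
  intro r hr
  obtain ⟨i, rfl⟩ := (residueEquiv n).surjective r
  have hr' : ¬ (s.coeff (residueEquiv n i) = 0 ∧ t.coeff (residueEquiv n i) = 0) := by
    simpa [Prod.ext_iff] using hr
  rw [Finset.mem_image]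
  by_cases hs : s.coeff (residueEquiv n i) = 0
  · have ht : t.coeff (residueEquiv n i) ≠ 0 := fun ht => hr' ⟨hs, ht⟩
    refine ⟨Fin.natAdd n i, ?_, Fin.append_right _ _ _⟩
    rw [Finset.mem_filter, Fin.append_right, word_apply, ← residueEquiv_apply]
    exact ⟨Finset.mem_univ _, mul_ne_zero (pow_ne_zero _ hlam) ht⟩
  · refine ⟨Fin.castAdd n i, ?_, Fin.append_left _ _ _⟩
    rw [Finset.mem_filter, Fin.append_left, word_apply, ← residueEquiv_apply]
    exact ⟨Finset.mem_univ _, mul_ne_zero (pow_ne_zero _ hlam) hs⟩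

lemma lt_relMinDist_doubleCirculant {lam : F} (hlam : lam ≠ 0) {b : CyclicAlgebra F n} {δ : ℝ}
    (h : ∀ s : CyclicAlgebra F n, s ≠ 0 → δ * n < pairWeight s (s * b)) :
    δ / 2 < relMinDist (doubleCirculant lam b) := by
  have hn : 0 < n := Nat.pos_of_neZero n
  have hbot : doubleCirculant lam b ≠ ⊥ := by
    intro hb
    have := finrank_doubleCirculant hlam b
    rw [hb, finrank_bot] at this
    omega
  obtain ⟨c, ⟨s, rfl⟩, h0, hd⟩ := exists_minDist_eq_hammingNorm hbot
  have hs : s ≠ 0 := by rintro rfl; exact h0 (map_zero _)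
  have hw : ((pairWeight s (s * b) : ℕ) : ℝ) ≤ minDist (doubleCirculant lam b) := by
    rw [hd]
    exact_mod_cast pairWeight_le_hammingNorm hlam s (s * b)
  have hn' : (0 : ℝ) < n := by exact_mod_cast hn
  rw [relMinDist, lt_div_iff₀ (by push_cast; positivity)]
  push_cast
  linarith [h s hs]

end DoubleCirculant

/-! ### Counting light codewords -/

section Counting

variable {F : Type*} [Field F]

/-- The element of the cyclic algebra of length `n` whose coefficients repeat the word `f` of
length `m`. It has period `m` when `m ∣ n`. -/
noncomputable def periodic {m : ℕ} (n : ℕ) [NeZero n] (f : ZMod m → F) : CyclicAlgebra F n :=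
  .ofCoeff (Finsupp.equivFunOnFinite.symm fun i => f (ZMod.cast i))

/-- The units `v` for which the code attached to `v` contains the pair `(s, t)`. -/
def solutions {n : ℕ} (e : F) (s t : CyclicAlgebra F n) : Set (CyclicAlgebra F n) :=
  {v | IsUnit v ∧ e • (s * v) = t * CyclicAlgebra.bar F n v}

variable {p : ℕ} [Fact p.Prime] [CharP F p]

lemma exists_periodic_eq [DecidableEq F] {n k j : ℕ} [NeZero n] (hn : n = p ^ k) (hj : j ≤ k)
    {s b : CyclicAlgebra F n} (hs : Module.finrank F (Ideal.span {s}) ≤ p ^ j) {δ : ℝ}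
    (hw : (pairWeight s (s * b) : ℝ) ≤ δ * n) :
    ∃ h : ZMod (p ^ j) → F × F, (hammingNorm h : ℝ) ≤ δ * (p ^ j : ℕ) ∧
      s = periodic n (fun i => (h i).1) ∧ s * b = periodic n (fun i => (h i).2) := by
  have hmn : p ^ j ∣ n := hn ▸ pow_dvd_pow p hj
  have hper := CyclicAlgebra.single_mul_eq_self hn hs
  have hper' : AddMonoidAlgebra.single ((p ^ j : ℕ) : ZMod n) 1 * (s * b) = s * b := by
    rw [← mul_assoc, hper]
  let h : ZMod (p ^ j) → F × F :=
    fun i => (s.coeff ((i.val : ℕ) : ZMod n), (s * b).coeff ((i.val : ℕ) : ZMod n))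
  have hs1 : ∀ i : ZMod n, s.coeff i = (h (ZMod.castHom hmn (ZMod (p ^ j)) i)).1 :=
    CyclicAlgebra.coeff_eq_of_single_mul_eq_self hmn hper
  have hs2 : ∀ i : ZMod n, (s * b).coeff i = (h (ZMod.castHom hmn (ZMod (p ^ j)) i)).2 :=
    CyclicAlgebra.coeff_eq_of_single_mul_eq_self hmn hper'
  refine ⟨h, ?_, by ext i; exact hs1 i, by ext i; exact hs2 i⟩
  have hpw : pairWeight s (s * b) = hammingNorm (h ∘ ZMod.castHom hmn (ZMod (p ^ j))) := by
    rw [pairWeight]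
    congr 1
    funext i
    exact Prod.ext (hs1 i) (hs2 i)
  have hcomp := hammingNorm_comp_castHom hmn h
  rw [← hpw] at hcomp
  have hcomp' : ((p ^ j : ℕ) : ℝ) * pairWeight s (s * b) = n * hammingNorm h := by
    exact_mod_cast hcomp
  have hn0 : (0 : ℝ) < n := by exact_mod_cast Nat.pos_of_neZero n
  refine le_of_mul_le_mul_left ?_ hn0
  rw [← hcomp']
  calc ((p ^ j : ℕ) : ℝ) * pairWeight s (s * b) ≤ ((p ^ j : ℕ) : ℝ) * (δ * n) := by gcongr
    _ = _ := by ring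

/-- A nonzero light codeword `(s, s * b)` has period `p ^ (i + 1)`, where `i` is not too small, and
the ideal of `s` has dimension larger than `p ^ i`. -/
lemma exists_periodic_eq_of_light [DecidableEq F] {n k i₀ : ℕ} [NeZero n] (hn : n = p ^ k)
    {s b : CyclicAlgebra F n} (hs : s ≠ 0) {δ : ℝ} (hδ : 0 < δ) (hi₀ : δ * p ^ i₀ < 1)
    (hw : (pairWeight s (s * b) : ℝ) ≤ δ * n) :
    ∃ i ∈ Finset.Ico i₀ k, p ^ i < Module.finrank F (Ideal.span {s}) ∧
      ∃ h : ZMod (p ^ (i + 1)) → F × F, (hammingNorm h : ℝ) ≤ δ * (p ^ (i + 1) : ℕ) ∧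
        s = periodic n (fun i => (h i).1) ∧ s * b = periodic n (fun i => (h i).2) := by
  have hp : 1 < p := (Fact.out : p.Prime).one_lt
  have hk : Module.finrank F (Ideal.span {s}) ≤ p ^ k := by
    refine le_of_le_of_eq (Submodule.finrank_le ((Ideal.span {s}).restrictScalars F)) ?_
    rw [CyclicAlgebra.finrank_eq, hn]
  obtain ⟨j, hjk, hspec, hmin⟩ : ∃ j ≤ k, Module.finrank F (Ideal.span {s}) ≤ p ^ j ∧
      ∀ i < j, p ^ i < Module.finrank F (Ideal.span {s}) := by
    have hex : ∃ j, Module.finrank F (Ideal.span {s}) ≤ p ^ j := ⟨k, hk⟩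
    classical
    exact ⟨Nat.find hex, Nat.find_min' hex hk, Nat.find_spec hex,
      fun i hi => not_le.1 (Nat.find_min hex hi)⟩
  obtain ⟨h, hh, h1, h2⟩ := exists_periodic_eq hn hjk hspec hw
  have hij : i₀ < j := by
    -- A period of length at most `p ^ i₀` would have weight less than one.
    by_contra hle
    have hlt : (hammingNorm h : ℝ) < 1 := by
      refine (hh.trans ?_).trans_lt hi₀
      push_cast
      have : (1 : ℝ) ≤ p := by exact_mod_cast hp.le
      gcongr
      omega
    have h0 : hammingNorm h = 0 := by
      have : hammingNorm h < 1 := by exact_mod_cast hlt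
      omega
    rw [hammingNorm_eq_zero] at h0
    apply hs
    rw [h1, h0]
    ext r
    rfl
  obtain ⟨i, rfl⟩ : ∃ i, j = i + 1 := ⟨j - 1, by omega⟩
  exact ⟨i, Finset.mem_Ico.2 ⟨by omega, by omega⟩, hmin i (Nat.lt_succ_self i), h, hh, h1, h2⟩

lemma card_solutions_mul_le [Finite F] {n : ℕ} [NeZero n] {e : F} (he : e ≠ 0)
    (s t : CyclicAlgebra F n) {σ : ℝ} (hq : σ ^ 4 = Nat.card F) {d : ℕ}
    (hd : d ≤ Module.finrank F (Ideal.span {s})) :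
    (Nat.card (solutions e s t) : ℝ) * σ ^ (2 * d) ≤ (Nat.card F : ℝ) ^ (n + 1) := by
  have h := sq_card_solutions_mul_le CyclicAlgebra.adjoin_gen CyclicAlgebra.bar_gen_mul_gen he s t
  rw [CyclicAlgebra.finrank_eq] at h
  have h' : (Nat.card (solutions e s t) : ℝ) ^ 2 *
      (Nat.card F : ℝ) ^ Module.finrank F (Ideal.span {s}) ≤ (Nat.card F : ℝ) ^ (2 * n + 2) := by
    exact_mod_cast h
  refine le_of_sq_le_sq ?_ (by positivity)
  calc ((Nat.card (solutions e s t) : ℝ) * σ ^ (2 * d)) ^ 2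
      = (Nat.card (solutions e s t) : ℝ) ^ 2 * (Nat.card F : ℝ) ^ d := by
        rw [← hq]; ring
    _ ≤ (Nat.card (solutions e s t) : ℝ) ^ 2 *
          (Nat.card F : ℝ) ^ Module.finrank F (Ideal.span {s}) := by
        have : (1 : ℝ) ≤ Nat.card F := by exact_mod_cast Nat.card_pos
        gcongr
    _ ≤ ((Nat.card F : ℝ) ^ (n + 1)) ^ 2 := by
        refine h'.trans (le_of_eq ?_)
        ring

omit [CharP F p] in
/-- The union bound over the light periodic words: for each `i`, the `A ^ p ^ (i + 1)` light words of
length `p ^ (i + 1)` cost only half of the exponent saved by the rank bound. -/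
lemma card_augmentation_eq_one_le [Finite F] [DecidableEq F] {n k i₀ : ℕ} [NeZero n]
    {e : F} (he : e ≠ 0) {A δ : ℝ} (hA : 1 < A) (hq : A ^ (4 * p) = Nat.card F)
    (hball : ∀ (ι : Type) [Fintype ι],
      (Nat.card {h : ι → F × F // (hammingNorm h : ℝ) ≤ δ * Fintype.card ι} : ℝ) ≤
        A ^ Fintype.card ι)
    (hcover : ∀ v : CyclicAlgebra F n, CyclicAlgebra.aug F n v = 1 → ∃ i ∈ Finset.Ico i₀ k,
      ∃ h : ZMod (p ^ (i + 1)) → F × F, (hammingNorm h : ℝ) ≤ δ * (p ^ (i + 1) : ℕ) ∧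
        p ^ i ≤ Module.finrank F (Ideal.span {periodic n (fun i => (h i).1)}) ∧
        v ∈ solutions e (periodic n (fun i => (h i).1)) (periodic n (fun i => (h i).2))) :
    (Nat.card {v : CyclicAlgebra F n // CyclicAlgebra.aug F n v = 1} : ℝ) ≤
      (Nat.card F : ℝ) ^ (n + 1) * ((A ^ p)⁻¹ ^ i₀ / (1 - (A ^ p)⁻¹)) := by
  classical
  have hp : 1 < p := (Fact.out : p.Prime).one_lt
  have hfin : Finite (CyclicAlgebra F n) := Module.finite_of_finite F
  have := Fintype.ofFinite F
  have := Fintype.ofFinite (CyclicAlgebra F n)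
  set σ := A ^ p with hσ
  have hσ1 : 1 < σ := one_lt_pow₀ hA (by omega)
  have hσ4 : σ ^ 4 = Nat.card F := by rw [hσ, ← pow_mul, mul_comm, hq]
  let B : ∀ i : ℕ, Finset (ZMod (p ^ (i + 1)) → F × F) := fun i =>
    Finset.univ.filter fun h => (hammingNorm h : ℝ) ≤ δ * (p ^ (i + 1) : ℕ) ∧
      p ^ i ≤ Module.finrank F (Ideal.span {periodic n (fun i => (h i).1)})
  let S : ∀ i : ℕ, (ZMod (p ^ (i + 1)) → F × F) → Finset (CyclicAlgebra F n) := fun i h =>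
    (solutions e (periodic n (fun i => (h i).1)) (periodic n (fun i => (h i).2))).toFinset
  have hB : ∀ i, ((B i).card : ℝ) ≤ σ ^ p ^ i := by
    intro i
    have h1 := hball (ZMod (p ^ (i + 1)))
    rw [Nat.card_eq_fintype_card, Fintype.card_subtype, ZMod.card] at h1
    refine (Nat.cast_le.2 (Finset.card_le_card fun h hh => ?_)).trans (h1.trans (le_of_eq ?_))
    · exact Finset.mem_filter.2 ⟨Finset.mem_univ _, (Finset.mem_filter.1 hh).2.1⟩
    · rw [hσ, ← pow_mul, pow_succ']
  have hS : ∀ i, ∀ h ∈ B i, ((S i h).card : ℝ) ≤ (Nat.card F : ℝ) ^ (n + 1) / σ ^ (2 * p ^ i) := by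
    intro i h hh
    rw [le_div_iff₀ (by positivity), Set.toFinset_card, ← Nat.card_eq_fintype_card]
    exact card_solutions_mul_le he _ _ hσ4 (Finset.mem_filter.1 hh).2.2
  have hsub : (Finset.univ.filter fun v : CyclicAlgebra F n => CyclicAlgebra.aug F n v = 1) ⊆
      (Finset.Ico i₀ k).biUnion fun i => (B i).biUnion (S i) := by
    intro v hv
    obtain ⟨i, hi, h, h1, h2, h3⟩ := hcover v (Finset.mem_filter.1 hv).2
    exact Finset.mem_biUnion.2 ⟨i, hi, Finset.mem_biUnion.2
      ⟨h, Finset.mem_filter.2 ⟨Finset.mem_univ _, h1, h2⟩, Set.mem_toFinset.2 h3⟩⟩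
  have hnat : (Finset.univ.filter fun v : CyclicAlgebra F n => CyclicAlgebra.aug F n v = 1).card ≤
      ∑ i ∈ Finset.Ico i₀ k, ∑ h ∈ B i, (S i h).card :=
    (Finset.card_le_card hsub).trans <| Finset.card_biUnion_le.trans <|
      Finset.sum_le_sum fun i _ => Finset.card_biUnion_le
  have hinv : σ⁻¹ < 1 := inv_lt_one_of_one_lt₀ hσ1
  rw [Nat.card_eq_fintype_card (α := {v : CyclicAlgebra F n // _}), Fintype.card_subtype]
  calc _ ≤ ((∑ i ∈ Finset.Ico i₀ k, ∑ h ∈ B i, (S i h).card : ℕ) : ℝ) := by exact_mod_cast hnat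
    _ = ∑ i ∈ Finset.Ico i₀ k, ∑ h ∈ B i, ((S i h).card : ℝ) := by push_cast; rfl
    _ ≤ ∑ i ∈ Finset.Ico i₀ k, (Nat.card F : ℝ) ^ (n + 1) * σ⁻¹ ^ i := by
        refine Finset.sum_le_sum fun i _ => ?_
        calc ∑ h ∈ B i, ((S i h).card : ℝ)
            ≤ (B i).card * ((Nat.card F : ℝ) ^ (n + 1) / σ ^ (2 * p ^ i)) := by
              rw [← nsmul_eq_mul]
              exact Finset.sum_le_card_nsmul _ _ _ (hS i)
          _ ≤ σ ^ p ^ i * ((Nat.card F : ℝ) ^ (n + 1) / σ ^ (2 * p ^ i)) := by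
              gcongr
              exact hB i
          _ = (Nat.card F : ℝ) ^ (n + 1) * σ⁻¹ ^ p ^ i := by
              rw [inv_pow]
              field_simp
              ring
          _ ≤ (Nat.card F : ℝ) ^ (n + 1) * σ⁻¹ ^ i := by
              refine mul_le_mul_of_nonneg_left ?_ (by positivity)
              exact pow_le_pow_of_le_one (by positivity) hinv.le (Nat.lt_pow_self hp).le
    _ = (Nat.card F : ℝ) ^ (n + 1) * ∑ i ∈ Finset.Ico i₀ k, σ⁻¹ ^ i := by rw [Finset.mul_sum]
    _ ≤ _ := by
        refine mul_le_mul_of_nonneg_left ?_ (by positivity)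
        exact geom_sum_Ico_le_of_lt_one (by positivity) hinv

/-- For every `k` there is an antiunitary element `b` of the cyclic algebra of length `p ^ k` whose
double circulant code has minimum distance proportional to the length. -/
lemma exists_antiunitary_pairWeight_gt (p : ℕ) [Fact p.Prime] [CharP F p] [Finite F]
    [DecidableEq F] {e : F} (he : e * e = -1) :
    ∃ δ : ℝ, 0 < δ ∧ ∀ (n k : ℕ) [NeZero n], n = p ^ k → ∃ b : CyclicAlgebra F n,
      b * CyclicAlgebra.bar F n b = -1 ∧
        ∀ s : CyclicAlgebra F n, s ≠ 0 → δ * n < pairWeight s (s * b) := by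
  have he0 : e ≠ 0 := by rintro rfl; simp at he
  have := Fintype.ofFinite F
  have hp : 1 < p := (Fact.out : p.Prime).one_lt
  have hq1 : (1 : ℝ) < Nat.card F := by exact_mod_cast Finite.one_lt_card
  -- With `A ^ (4 * p) = q`, there are at most `q ^ (p ^ i / 4)` light words of length `p ^ (i + 1)`,
  -- and each excludes a proportion of order `q ^ (-p ^ i / 2)` of the units.
  set A : ℝ := (Nat.card F : ℝ) ^ (((4 * p : ℕ) : ℝ)⁻¹) with hAdef
  have hAq : A ^ (4 * p) = Nat.card F := Real.rpow_inv_natCast_pow (by positivity) (by omega)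
  have hA : 1 < A := Real.one_lt_rpow hq1 (by positivity)
  obtain ⟨δ₁, hδ₁, hball⟩ := exists_card_hammingBall_le (F × F) hA
  have hσ1 : 1 < A ^ p := one_lt_pow₀ hA (by omega)
  have hinv : (A ^ p)⁻¹ < 1 := inv_lt_one_of_one_lt₀ hσ1
  obtain ⟨i₀, hi₀⟩ := exists_pow_lt_of_lt_one
    (show 0 < (1 - (A ^ p)⁻¹) / (Nat.card F : ℝ) ^ 2 by
      exact div_pos (by linarith) (by positivity)) hinv
  refine ⟨min δ₁ (1 / (2 * p ^ i₀)), by positivity, fun n k _ hn => ?_⟩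
  set δ := min δ₁ (1 / (2 * (p : ℝ) ^ i₀)) with hδ
  have hδ0 : 0 < δ := by positivity
  have hδi : δ * p ^ i₀ < 1 := by
    have : δ ≤ 1 / (2 * (p : ℝ) ^ i₀) := min_le_right _ _
    have hpos : (0 : ℝ) < (p : ℝ) ^ i₀ := by positivity
    rw [le_div_iff₀ (by positivity)] at this
    linarith
  by_contra! hcon
  have hfin : Finite (CyclicAlgebra F n) := Module.finite_of_finite F
  have hcard := card_augmentation_eq_one_le (n := n) (k := k) (i₀ := i₀) he0 hA hAq hball ?_
  · have hle := card_le_card_augmentation_eq_one_mul (CyclicAlgebra.aug F n)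
    rw [Module.natCard_eq_pow_finrank (K := F), CyclicAlgebra.finrank_eq] at hle
    have hle' : (Nat.card F : ℝ) ^ n ≤
        (Nat.card {v : CyclicAlgebra F n // CyclicAlgebra.aug F n v = 1} : ℝ) * Nat.card F := by
      exact_mod_cast hle
    have hlt : (Nat.card F : ℝ) ^ 2 * ((A ^ p)⁻¹ ^ i₀ / (1 - (A ^ p)⁻¹)) < 1 := by
      rw [lt_div_iff₀ (by positivity)] at hi₀
      rw [mul_div_assoc', div_lt_one (by linarith)]
      linarith
    have hqn : (0 : ℝ) < (Nat.card F : ℝ) ^ n := by positivity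
    have := calc (Nat.card F : ℝ) ^ n ≤ (Nat.card F : ℝ) ^ (n + 1) *
          ((A ^ p)⁻¹ ^ i₀ / (1 - (A ^ p)⁻¹)) * Nat.card F := hle'.trans (by gcongr)
      _ = (Nat.card F : ℝ) ^ n *
          ((Nat.card F : ℝ) ^ 2 * ((A ^ p)⁻¹ ^ i₀ / (1 - (A ^ p)⁻¹))) := by ring
      _ < (Nat.card F : ℝ) ^ n * 1 := by gcongr
    linarith
  · intro v hv
    have hu : IsUnit v := isUnit_of_augmentation_eq_one CyclicAlgebra.adjoin_gen
      (CyclicAlgebra.isNilpotent_gen_sub_one hn) (CyclicAlgebra.aug F n) hv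
    obtain ⟨w, hw⟩ := hu.exists_right_inv
    have hw' : CyclicAlgebra.bar F n v * CyclicAlgebra.bar F n w = 1 := by
      rw [← map_mul, hw, map_one]
    have hee : algebraMap F (CyclicAlgebra F n) e * algebraMap F (CyclicAlgebra F n) e = -1 := by
      rw [← map_mul, he, map_neg, map_one]
    obtain ⟨s, hs, hlight⟩ := hcon (e • (v * CyclicAlgebra.bar F n w)) (by
      rw [map_smul, map_mul, CyclicAlgebra.bar_bar, Algebra.smul_def, Algebra.smul_def]
      linear_combination (v * w * CyclicAlgebra.bar F n v * CyclicAlgebra.bar F n w) * hee -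
        CyclicAlgebra.bar F n v * CyclicAlgebra.bar F n w * hw - hw')
    obtain ⟨i, hi, hrank, h, hnorm, h1, h2⟩ := exists_periodic_eq_of_light hn hs hδ0 hδi hlight
    refine ⟨i, hi, h, hnorm.trans (by gcongr; exact min_le_left _ _), ?_, hu, ?_⟩
    · rw [← h1]
      exact hrank.le
    · rw [← h1, ← h2, Algebra.smul_def, Algebra.smul_def]
      linear_combination -(algebraMap F (CyclicAlgebra F n) e * s * v) * hw'

end Counting

lemma asymptoticallyGood_of_sq_eq_one {F : Type*} [Field F] [Finite F] [DecidableEq F] {e lam : F}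
    (he : e * e = -1) (hsq : lam ^ 2 = 1) : AsymptoticallyGood (selfDualTwoQuasi F lam) := by
  have hlam : lam ≠ 0 := by rintro rfl; simp at hsq
  obtain ⟨p, hchar⟩ := CharP.exists F
  have hp : Fact p.Prime := ⟨CharP.char_is_prime F p⟩
  -- `lam = ± 1` lies in the prime field, so it is fixed by the Frobenius map.
  have hpow : ∀ k : ℕ, lam ^ p ^ k = lam := by
    intro k
    rcases mul_self_eq_one_iff.1 ((sq lam).symm.trans hsq) with rfl | rfl
    · exact one_pow _
    · exact neg_one_pow_char_pow F p k
  obtain ⟨δ, hδ, h⟩ := exists_antiunitary_pairWeight_gt p he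
  choose b hb hw using fun k : ℕ => h (p ^ k) k rfl
  refine ⟨fun k => ⟨p ^ k + p ^ k, doubleCirculant lam (b k)⟩, fun k =>
    ⟨p ^ k, Nat.pos_of_neZero _, _, isTwoQuasiConstacyclic_doubleCirculant hsq (hpow k) _,
      isSelfDual_doubleCirculant hsq (hb k), rfl⟩, ?_, min (δ / 2) (1 / 4), by positivity,
    fun k => ⟨?_, (min_le_left _ _).trans_lt (lt_relMinDist_doubleCirculant hlam (hw k))⟩⟩
  · refine tendsto_atTop_mono (fun k => ?_) tendsto_id
    have := (Nat.lt_pow_self (n := k) hp.out.one_lt).le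
    simp only [id]
    omega
  · refine (min_le_right _ _).trans_lt ?_
    have hpk : (0 : ℝ) < (p : ℝ) ^ k := by
      have := hp.out.pos
      positivity
    rw [rate, finrank_doubleCirculant hlam, lt_div_iff₀ (by push_cast; positivity)]
    push_cast
    linarith

end TwoQuasi

theorem mainTheorem2 {F : Type*} [Field F] [Fintype F] [DecidableEq F]
    (hq : ¬ Fintype.card F ≡ 3 [MOD 4]) (lam : F) (hlam : lam ≠ 0) :
    TwoQuasi.AsymptoticallyGood (TwoQuasi.selfDualTwoQuasi F lam) ↔ lam ^ 2 = 1 := by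
  refine ⟨TwoQuasi.sq_eq_one_of_asymptoticallyGood hlam, fun hsq => ?_⟩
  obtain ⟨e, he⟩ := FiniteField.isSquare_neg_one_iff.2 (fun h : Fintype.card F % 4 = 3 => hq h)
  exact TwoQuasi.asymptoticallyGood_of_sq_eq_one he.symm hsq
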